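/- Let $J \ge 0$ be an integer and let $0 < a_1 \le a_2 \le \cdots \le a_J$ and $0 \le b_1 \le b_2 \le \cdots \le b_J$ be real numbers such that $\sum_{j=1}^{L} a_j \le \sum_{j=1}^{L} b_j$ for each $L = 1, 2, \dots, J$. Define $$\mu_n = \frac{\prod_{j=1}^{J} \Gamma(n + a_j)}{\prod_{j=1}^{J} \Gamma(n + b_j)}, \qquad n \ge 0.$$ Then $(\mu_n)_{n \ge 0}$ is a Hausdorff moment sequence on $[0,1]$: $\mu_0 > 0$, and there is a random variable $X$ with values in $[0,1]$ such that $\mathbb{E}(X^n) = \mu_n / \mu_0$ for every integer $n \ge 0$. -/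

import Mathlib

open MeasureTheory

/-- A real sequence `m` is a *Hausdorff moment sequence* on the compact interval `[c, d]`: `m 0` is
positive, and there is a random variable `X` with values in `[c, d]` (given here by its law `ν`)
such that `𝔼[X ^ n] = m n / m 0` for every `n`. The powers are bounded on `[c, d]`, hence
integrable. -/
def IsHausdorffMomentSequence (c d : ℝ) (m : ℕ → ℝ) : Prop :=
  0 < m 0 ∧ ∃ ν : Measure ℝ, IsProbabilityMeasure ν ∧ ν (Set.Icc c d)ᶜ = 0 ∧
    ∀ n : ℕ, ∫ x, x ^ n ∂ν = m n / m 0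

open Filter Topology

/-! Frullani's integral gives log((n+b)/(n+a)) = ∫₀^∞ e^(-nt) (e^(-at) - e^(-bt))/t dt. Summed over
j, the density is nonnegative once ∑ e^(-b_j t) ≤ ∑ e^(-a_j t), which the partial-sum condition
yields because x ↦ e^(-tx) is convex and decreasing. Substituting x = e^(-t) then exhibits the sum
of logarithms as moments of a finite measure on [0,1]. Such moment sequences are closed under sums,
products and pointwise limits, hence under exp, so ∏ (n+b_j)/(n+a_j) is one too. Shifting all a_j
and b_j by k multiplies both exponential sums by e^(-kt), and Euler's limit for Γ writes the Gamma
ratio as a limit of products of the shifted ratios with positive constants. -/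

/-- The sequence `m` consists of the moments of a finite measure on the unit interval. -/
def IsUnitIntervalMoment (m : ℕ → ℝ) : Prop :=
  ∃ ν : FiniteMeasure unitInterval, ∀ n, ∫ x, (x : ℝ) ^ n ∂(ν : Measure unitInterval) = m n

namespace IsUnitIntervalMoment

theorem integrable_pow (ν : Measure unitInterval) [IsFiniteMeasure ν] (n : ℕ) :
    Integrable (fun x : unitInterval => (x : ℝ) ^ n) ν :=
  (by fun_prop : Continuous fun x : unitInterval => (x : ℝ) ^ n).integrable_of_hasCompactSupport
    (HasCompactSupport.of_compactSpace _)

theorem const {c : ℝ} (hc : 0 ≤ c) : IsUnitIntervalMoment fun _ => c := by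
  refine ⟨⟨ENNReal.ofReal c • Measure.dirac 1, ?_⟩, fun n => ?_⟩
  · exact Measure.smul_finite _ ENNReal.ofReal_ne_top
  · simp [integral_smul_measure, hc]

theorem add {m₁ m₂ : ℕ → ℝ} (h₁ : IsUnitIntervalMoment m₁) (h₂ : IsUnitIntervalMoment m₂) :
    IsUnitIntervalMoment fun n => m₁ n + m₂ n := by
  obtain ⟨ν₁, h₁⟩ := h₁
  obtain ⟨ν₂, h₂⟩ := h₂
  refine ⟨ν₁ + ν₂, fun n => ?_⟩
  rw [FiniteMeasure.toMeasure_add, integral_add_measure (integrable_pow _ n) (integrable_pow _ n),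
    h₁, h₂]

/-- Push the product measure forward under multiplication: moments of a product of independent
variables multiply. -/
theorem mul {m₁ m₂ : ℕ → ℝ} (h₁ : IsUnitIntervalMoment m₁) (h₂ : IsUnitIntervalMoment m₂) :
    IsUnitIntervalMoment fun n => m₁ n * m₂ n := by
  obtain ⟨ν₁, h₁⟩ := h₁
  obtain ⟨ν₂, h₂⟩ := h₂
  refine ⟨(ν₁.prod ν₂).map fun p => p.1 * p.2, fun n => ?_⟩
  have hmul : Measurable fun p : unitInterval × unitInterval => p.1 * p.2 :=
    (by fun_prop : Continuous fun p : unitInterval × unitInterval => p.1 * p.2).measurable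
  rw [FiniteMeasure.toMeasure_map, FiniteMeasure.toMeasure_prod,
    integral_map hmul.aemeasurable
      (by fun_prop : Continuous fun x : unitInterval => (x : ℝ) ^ n).aestronglyMeasurable]
  simp only [Set.Icc.coe_mul, mul_pow]
  rw [integral_prod_mul (fun x : unitInterval => (x : ℝ) ^ n)
    (fun x : unitInterval => (x : ℝ) ^ n), h₁, h₂]

theorem pow {m : ℕ → ℝ} (h : IsUnitIntervalMoment m) (k : ℕ) :
    IsUnitIntervalMoment fun n => m n ^ k := by
  induction k with
  | zero => simpa using const zero_le_one
  | succ k ih => simpa only [pow_succ] using ih.mul h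

theorem sum {ι : Type*} (s : Finset ι) {m : ι → ℕ → ℝ}
    (h : ∀ i, IsUnitIntervalMoment (m i)) : IsUnitIntervalMoment fun n => ∑ i ∈ s, m i n := by
  classical
  induction s using Finset.induction_on with
  | empty => simpa using const le_rfl
  | insert i s hi ih => simpa only [Finset.sum_insert hi] using (h i).add ih

theorem prod {ι : Type*} (s : Finset ι) {m : ι → ℕ → ℝ}
    (h : ∀ i, IsUnitIntervalMoment (m i)) : IsUnitIntervalMoment fun n => ∏ i ∈ s, m i n := by
  classical
  induction s using Finset.induction_on with
  | empty => simpa using const zero_le_one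
  | insert i s hi ih => simpa only [Finset.prod_insert hi] using (h i).mul ih

/-- Convergence of the zeroth moments bounds the masses, so weak compactness applies; a limit along
an ultrafilter replaces a convergent subsequence. -/
theorem of_tendsto {m : ℕ → ℕ → ℝ} {l : ℕ → ℝ} (h : ∀ k, IsUnitIntervalMoment (m k))
    (hl : ∀ n, Tendsto (fun k => m k n) atTop (𝓝 (l n))) : IsUnitIntervalMoment l := by
  choose ν hν using h
  obtain ⟨C, hC⟩ := (hl 0).bddAbove_range
  have hmass (k : ℕ) : (ν k).mass ≤ C.toNNReal := by
    have h0 : ((ν k).mass : ℝ) = m k 0 := by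
      rw [← hν k 0]
      simp only [pow_zero, integral_const, smul_eq_mul, mul_one]
      rfl
    rw [← NNReal.coe_le_coe, h0]
    exact (hC ⟨k, rfl⟩).trans (Real.le_coe_toNNReal C)
  obtain ⟨μ, -, hμ⟩ :=
    (isCompact_setOfPred_finiteMeasure_le_of_compactSpace unitInterval
      C.toNNReal).ultrafilter_le_nhds ((hyperfilter ℕ).map ν)
      (le_principal_iff.2 (mem_map.2 (univ_mem' hmass)))
  refine ⟨μ, fun n => ?_⟩
  have ht := FiniteMeasure.tendsto_iff_forall_integral_tendsto.1
    (show Tendsto ν (hyperfilter ℕ) (𝓝 μ) from hμ)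
    (BoundedContinuousFunction.mkOfCompact ⟨fun x => (x : ℝ) ^ n, by fun_prop⟩)
  simp only [BoundedContinuousFunction.mkOfCompact_apply, ContinuousMap.coe_mk, hν] at ht
  exact tendsto_nhds_unique ht ((hl n).mono_left Nat.hyperfilter_le_atTop)

theorem exp {m : ℕ → ℝ} (h : IsUnitIntervalMoment m) :
    IsUnitIntervalMoment fun n => Real.exp (m n) := by
  refine of_tendsto (m := fun k n => ∑ i ∈ Finset.range k, ((i.factorial : ℝ)⁻¹ * m n ^ i))
    (fun k => sum _ fun i => (const (by positivity)).mul (h.pow i)) fun n => ?_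
  have := (NormedSpace.exp_series_hasSum_exp' (𝕂 := ℝ) (m n)).tendsto_sum_nat
  rwa [← Real.exp_eq_exp_ℝ] at this

theorem isHausdorffMomentSequence {m : ℕ → ℝ} (h : IsUnitIntervalMoment m) (h0 : 0 < m 0) :
    IsHausdorffMomentSequence 0 1 m := by
  obtain ⟨ν, hν⟩ := h
  have hmass : (ν : Measure unitInterval) Set.univ = ENNReal.ofReal (m 0) := by
    rw [← hν 0]
    simp
  refine ⟨h0, (ENNReal.ofReal (m 0))⁻¹ • (ν : Measure unitInterval).map Subtype.val, ⟨?_⟩, ?_,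
    fun n => ?_⟩
  · rw [Measure.smul_apply, Measure.map_apply measurable_subtype_coe .univ, Set.preimage_univ,
      hmass, smul_eq_mul, ENNReal.inv_mul_cancel (by simpa using h0) ENNReal.ofReal_ne_top]
  · rw [Measure.smul_apply, Measure.map_apply measurable_subtype_coe measurableSet_Icc.compl]
    have : (Subtype.val ⁻¹' (Set.Icc (0 : ℝ) 1)ᶜ : Set unitInterval) = ∅ := by
      ext x
      simp
    rw [this]
    simp
  · rw [integral_smul_measure, integral_map measurable_subtype_coe.aemeasurable
      (by fun_prop : Continuous fun x : ℝ => x ^ n).aestronglyMeasurable, hν, ENNReal.toReal_inv,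
      ENNReal.toReal_ofReal h0.le, smul_eq_mul, inv_mul_eq_div]

end IsUnitIntervalMoment

theorem integrableOn_inv_mul_exp_sub_exp {a b : ℝ} (ha : 0 < a) (hb : 0 < b) :
    IntegrableOn (fun t => t⁻¹ * (Real.exp (-(a * t)) - Real.exp (-(b * t)))) (Set.Ioi 0) := by
  wlog hab : a ≤ b generalizing a b
  · refine (this hb ha (le_of_not_ge hab)).neg.congr (ae_of_all _ fun t => ?_)
    simp only [Pi.neg_apply]
    ring
  refine Integrable.mono' ((exp_neg_integrableOn_Ioi 0 ha).const_mul (b - a))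
    (Measurable.aestronglyMeasurable (by fun_prop)) ?_
  filter_upwards [ae_restrict_mem measurableSet_Ioi] with t (ht : 0 < t)
  have hle : Real.exp (-(b * t)) ≤ Real.exp (-(a * t)) := Real.exp_le_exp.2 (by nlinarith)
  -- The dominating function (b - a) e^(-at) comes from 1 - e^(-s) ≤ s with s = (b - a)t.
  rw [Real.norm_of_nonneg (mul_nonneg (inv_nonneg.2 ht.le) (sub_nonneg.2 hle)),
    inv_mul_le_iff₀ ht]
  have h1 := Real.add_one_le_exp (-((b - a) * t))
  have h2 : Real.exp (-(b * t)) = Real.exp (-(a * t)) * Real.exp (-((b - a) * t)) := by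
    rw [← Real.exp_add]
    ring_nf
  rw [h2, neg_mul]
  nlinarith [Real.exp_pos (-(a * t))]

theorem integral_inv_mul_exp_sub_exp {a b : ℝ} (ha : 0 < a) (hb : 0 < b) :
    ∫ t in Set.Ioi 0, t⁻¹ * (Real.exp (-(a * t)) - Real.exp (-(b * t))) = Real.log (b / a) := by
  have hc : Continuous fun x : ℝ => Real.exp (-x) := by fun_prop
  have h := Frullani.integral_Ioi_eq (f := fun x : ℝ => Real.exp (-x)) (L := 1) (R := 0)
    (hc.locallyIntegrable.locallyIntegrableOn _) ha hb
    (by simpa using (hc.tendsto 0).mono_left nhdsWithin_le_nhds)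
    (Real.tendsto_exp_neg_atTop_nhds_zero) (integrableOn_inv_mul_exp_sub_exp ha hb)
  simpa using h

theorem isUnitIntervalMoment_sum_log {ι : Type*} [Fintype ι] {a b : ι → ℝ}
    (ha : ∀ j, 0 < a j) (hb : ∀ j, 0 < b j)
    (hab : ∀ t, 0 < t → ∑ j, Real.exp (-(b j * t)) ≤ ∑ j, Real.exp (-(a j * t))) :
    IsUnitIntervalMoment fun n => ∑ j, Real.log ((n + b j) / (n + a j)) := by
  set f : ℝ → ℝ := fun t => t⁻¹ * ∑ j, (Real.exp (-(a j * t)) - Real.exp (-(b j * t))) with hf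
  have hf_meas : Measurable f := by fun_prop
  have hf_nonneg : ∀ᵐ t ∂volume.restrict (Set.Ioi 0), 0 ≤ f t := by
    filter_upwards [ae_restrict_mem measurableSet_Ioi] with t (ht : 0 < t)
    refine mul_nonneg (inv_nonneg.2 ht.le) ?_
    rw [Finset.sum_sub_distrib]
    exact sub_nonneg.2 (hab t ht)
  have hf_int : IntegrableOn f (Set.Ioi 0) := by
    simp only [hf, Finset.mul_sum]
    exact integrable_finsetSum _ fun j _ => integrableOn_inv_mul_exp_sub_exp (ha j) (hb j)
  -- The projection only makes the map total; for t > 0 it leaves e^(-t) unchanged.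
  let e : ℝ → unitInterval := fun t => Set.projIcc 0 1 zero_le_one (Real.exp (-t))
  have he : Measurable e := (continuous_projIcc.comp (by fun_prop)).measurable
  let κ : Measure ℝ := (volume.restrict (Set.Ioi 0)).withDensity fun t => ENNReal.ofReal (f t)
  have : IsFiniteMeasure κ := isFiniteMeasure_withDensity_ofReal hf_int.2
  refine ⟨⟨κ.map e, inferInstance⟩, fun n => ?_⟩
  rw [FiniteMeasure.toMeasure_mk, integral_map he.aemeasurable
      (by fun_prop : Continuous fun x : unitInterval => (x : ℝ) ^ n).aestronglyMeasurable,
    integral_withDensity_eq_integral_toReal_smul (by fun_prop)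
      (ae_of_all _ fun _ => ENNReal.ofReal_lt_top)]
  calc
    _ = ∫ t in Set.Ioi 0, ∑ j, t⁻¹ * (Real.exp (-((n + a j) * t)) - Real.exp (-((n + b j) * t))) := by
      refine integral_congr_ae ?_
      filter_upwards [ae_restrict_mem measurableSet_Ioi, hf_nonneg] with t (ht : 0 < t) hft
      have het : (e t : ℝ) = Real.exp (-t) := by
        simp only [e, Set.coe_projIcc]
        rw [min_eq_right (Real.exp_le_one_iff.2 (by linarith)), max_eq_right (Real.exp_pos _).le]
      have hexp (c : ℝ) : Real.exp (-((n + c) * t)) = Real.exp (-(c * t)) * Real.exp (-t) ^ n := by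
        rw [← Real.exp_nat_mul, ← Real.exp_add]
        ring_nf
      rw [ENNReal.toReal_ofReal hft, het, smul_eq_mul, hf]
      simp only [hexp, ← sub_mul, ← mul_assoc, ← Finset.sum_mul, Finset.mul_sum]
    _ = _ := by
      rw [integral_finsetSum _ fun j _ => integrableOn_inv_mul_exp_sub_exp
        (by have := ha j; positivity) (by have := hb j; positivity)]
      exact Finset.sum_congr rfl fun j _ => integral_inv_mul_exp_sub_exp
        (by have := ha j; positivity) (by have := hb j; positivity)

theorem isUnitIntervalMoment_prod_div {ι : Type*} [Fintype ι] {a b : ι → ℝ}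
    (ha : ∀ j, 0 < a j) (hb : ∀ j, 0 < b j)
    (hab : ∀ t, 0 < t → ∑ j, Real.exp (-(b j * t)) ≤ ∑ j, Real.exp (-(a j * t))) :
    IsUnitIntervalMoment fun n => ∏ j, ((n + b j) / (n + a j)) := by
  have h := (isUnitIntervalMoment_sum_log ha hb hab).exp
  simp only [Real.exp_sum] at h
  convert h using 4 with n j
  have := ha j
  have := hb j
  rw [Real.exp_log (by positivity)]

theorem Real.GammaSeq_div_GammaSeq (x y : ℝ) {N : ℕ} (hN : N ≠ 0) :
    Real.GammaSeq x N / Real.GammaSeq y N =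
      (N : ℝ) ^ (x - y) * ∏ k ∈ Finset.range (N + 1), ((y + k) / (x + k)) := by
  have hN' : (0 : ℝ) < N := by positivity
  have := (Real.rpow_pos_of_pos hN' y).ne'
  have : (N.factorial : ℝ) ≠ 0 := by positivity
  rw [Real.GammaSeq, Real.GammaSeq, Real.rpow_sub hN', Finset.prod_div_distrib, div_div_div_eq,
    div_mul_div_comm, mul_right_comm, mul_left_comm, ← mul_assoc ((N : ℝ) ^ y),
    mul_div_mul_right _ _ this]

theorem isUnitIntervalMoment_prod_Gamma_div {ι : Type*} [Fintype ι] {a b : ι → ℝ}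
    (ha : ∀ j, 0 < a j) (hb : ∀ j, 0 < b j)
    (hab : ∀ t, 0 < t → ∑ j, Real.exp (-(b j * t)) ≤ ∑ j, Real.exp (-(a j * t))) :
    IsUnitIntervalMoment
      fun n => (∏ j, Real.Gamma (n + a j)) / ∏ j, Real.Gamma (n + b j) := by
  -- In the quotient of Euler approximants n cancels from the exponent, so the power prefactor is
  -- constant in n. The index N + 1 keeps the base of the power positive.
  refine IsUnitIntervalMoment.of_tendsto (m := fun N n =>
    (∏ j, ((N + 1 : ℕ) : ℝ) ^ (a j - b j)) *
      ∏ k ∈ Finset.range (N + 1 + 1), ∏ j, ((n + (b j + k)) / (n + (a j + k)))) (fun N => ?_)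
    fun n => ?_
  · refine (IsUnitIntervalMoment.const (by positivity)).mul (.prod _ fun k =>
      isUnitIntervalMoment_prod_div (fun j => ?_) (fun j => ?_) fun t ht => ?_)
    · have := ha j
      positivity
    · have := hb j
      positivity
    · simp only [add_mul, neg_add, Real.exp_add, ← Finset.sum_mul]
      exact mul_le_mul_of_nonneg_right (hab t ht) (Real.exp_pos _).le
  · simp only [← Finset.prod_div_distrib]
    refine (tendsto_finsetProd _ fun j _ => ((Real.GammaSeq_tendsto_Gamma (n + a j)).div
      (Real.GammaSeq_tendsto_Gamma (n + b j)) (Real.Gamma_pos_of_pos ?_).ne').comp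
        (tendsto_add_atTop_nat 1)).congr fun N => ?_
    · have := hb j
      positivity
    · simp only [Function.comp_apply, Pi.div_apply,
        Real.GammaSeq_div_GammaSeq _ _ (Nat.succ_ne_zero N), Finset.prod_mul_distrib,
        add_sub_add_left_eq_sub, add_assoc]
      congr 1
      exact Finset.prod_comm

/-- Abel summation by induction: the last weight serves as the constant for the shorter sum, and is
then lowered to `c` using the nonnegative total. The free `c` is there for this induction; only `c =
0` is used later. -/
theorem Fin.mul_sum_le_sum_mul_of_antitone {J : ℕ} {w d : Fin J → ℝ} {c : ℝ} (hc : 0 ≤ c)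
    (hcw : ∀ j, c ≤ w j) (hw : Antitone w) (hd : ∀ L, 0 ≤ ∑ j ∈ Finset.Iic L, d j) :
    c * ∑ j, d j ≤ ∑ j, w j * d j := by
  induction J generalizing c with
  | zero => simp
  | succ J ih =>
    have h := ih (w := fun j => w j.castSucc) (d := fun j => d j.castSucc)
      (hc.trans (hcw (Fin.last J))) (fun j => hw (Fin.le_last _))
      (fun i j hij => hw (Fin.castSucc_le_castSucc_iff.2 hij)) fun L => by
        simpa [← Fin.map_castSuccEmb_Iic] using hd L.castSucc
    have hlast : Finset.Iic (Fin.last J) = Finset.univ := Finset.Iic_top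
    have hsum := hd (Fin.last J)
    rw [hlast, Fin.sum_univ_castSucc] at hsum
    rw [Fin.sum_univ_castSucc, Fin.sum_univ_castSucc]
    nlinarith [mul_le_mul_of_nonneg_right (hcw (Fin.last J)) hsum]

/-- A case of the Tomić–Weyl inequality for weakly majorized tuples. -/
theorem sum_exp_neg_mul_le_sum_exp_neg_mul {J : ℕ} {a b : Fin J → ℝ} (hb : Monotone b)
    (hab : ∀ L, ∑ j ∈ Finset.Iic L, a j ≤ ∑ j ∈ Finset.Iic L, b j) {t : ℝ} (ht : 0 ≤ t) :
    ∑ j, Real.exp (-(b j * t)) ≤ ∑ j, Real.exp (-(a j * t)) := by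
  have h := Fin.mul_sum_le_sum_mul_of_antitone (w := fun j => Real.exp (-(b j * t)))
    (d := fun j => b j - a j) le_rfl (fun j => (Real.exp_pos _).le)
    (fun i j hij => Real.exp_le_exp.2 (neg_le_neg (mul_le_mul_of_nonneg_right (hb hij) ht)))
    fun L => by simpa using hab L
  rw [zero_mul] at h
  rw [← sub_nonneg, ← Finset.sum_sub_distrib]
  refine (mul_nonneg ht h).trans ?_
  rw [Finset.mul_sum]
  refine Finset.sum_le_sum fun j _ => ?_
  -- Convexity: the tangent line to x ↦ e^(-tx) at b_j lies below its value at a_j.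
  have h1 := Real.add_one_le_exp ((b j - a j) * t)
  have h2 : Real.exp (-(a j * t)) = Real.exp (-(b j * t)) * Real.exp ((b j - a j) * t) := by
    rw [← Real.exp_add]
    ring_nf
  rw [h2]
  nlinarith [Real.exp_pos (-(b j * t))]

theorem proposition3p1 (J : ℕ) (a b : Fin J → ℝ)
    (ha_pos : ∀ j, 0 < a j) (ha : Monotone a)
    (hb_nonneg : ∀ j, 0 ≤ b j) (hb : Monotone b)
    (hab : ∀ L : Fin J, ∑ j ∈ Finset.Iic L, a j ≤ ∑ j ∈ Finset.Iic L, b j) :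
    IsHausdorffMomentSequence 0 1
      (fun n : ℕ => (∏ j, Real.Gamma ((n : ℝ) + a j)) / ∏ j, Real.Gamma ((n : ℝ) + b j)) := by
  -- The one-term partial sums give 0 < a_0 ≤ b_0, and `b` is monotone.
  have hb_pos (j : Fin J) : 0 < b j := by
    have : NeZero J := ⟨j.pos.ne'⟩
    have h0 : Finset.Iic (0 : Fin J) = {0} := by
      ext j
      simp
    have h := hab 0
    rw [h0, Finset.sum_singleton, Finset.sum_singleton] at h
    exact ((ha_pos 0).trans_le h).trans_le (hb (Fin.zero_le j))
  refine (isUnitIntervalMoment_prod_Gamma_div ha_pos hb_pos fun t ht =>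
    sum_exp_neg_mul_le_sum_exp_neg_mul hb hab ht.le).isHausdorffMomentSequence ?_
  refine div_pos (Finset.prod_pos fun j _ => Real.Gamma_pos_of_pos ?_)
    (Finset.prod_pos fun j _ => Real.Gamma_pos_of_pos ?_)
  · simpa using ha_pos j
  · simpa using hb_pos j
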